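/- Let $\mathcal Y\subset\mathbb R$ be a Borel set, let $f_1,\dots,f_M$ be probability densities on $\mathcal Y$ with respect to Lebesgue measure, with cdfs $F_1,\dots,F_M$, and let $\omega_0=(\omega_{0,1},\dots,\omega_{0,M})$ be a fixed point of the unit simplex $\Delta_M=\{\omega\in[0,1]^M:\sum_m\omega_m=1\}$. Put $$h(y|\omega_0)=\sum_{m=1}^M\omega_{0,m}f_m(y),\qquad H(y|\omega_0)=\sum_{m=1}^M\omega_{0,m}F_m(y).$$ For $(\mu,\nu)\in\Theta:=(0,1)\times(0,\infty)$ let $$b^*_{\mu,\nu}(x)=\frac{\Gamma(\nu)}{\Gamma(\mu\nu)\Gamma((1-\mu)\nu)}\,x^{\mu\nu-1}(1-x)^{(1-\mu)\nu-1},\qquad 0<x<1.$$ Let $\psi>0$, let $G_0$ be a probability measure on $\Theta$, let $G\sim DP(\psi,G_0)$ be a Dirichlet process with concentration parameter $\psi$ and base measure $G_0$, and let $\Pi^*$ be the prior on the set $\mathcal F$ of probability densities on $\mathcal Y$ induced by $$G\mapsto f_G,\qquad f_G(y)=\Big(\int_\Theta b^*_{\mu,\nu}(H(y|\omega_0))\,G(d\mu\,d\nu)\Big)h(y|\omega_0).$$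 For $f\in\mathcal F$ write $f\in KL(\Pi^*)$ if $\Pi^*\{g\in\mathcal F:\int f\log(f/g)\le\varepsilon\}>0$ for every $\varepsilon>0$. Let $(\mu_0,\nu_0)\in\Theta$, $w_0\in[0,1]$, let $P_0$ be a probability measure on $\Theta$, and set $$u_0(x)=w_0\,b^*_{\mu_0,\nu_0}(x)+(1-w_0)\int_\Theta b^*_{\mu,\nu}(x)\,P_0(d\mu\,d\nu),\qquad f_0(y)=u_0(H(y|\omega_0))\,h(y|\omega_0).$$ Assume that $(\mu_0,\nu_0)\in\mathrm{supp}(G_0)$, that $\mathrm{supp}(P_0)\subset\mathrm{supp}(G_0)$, and that for some $\zeta>0$ and some $0<\eta<\min(\mu_0,1-\mu_0,\nu_0,w_0)$ $$\int_0^1\frac{u_0(x)^{\zeta+1}}{x^{\zeta A}(1-x)^{\zeta B}}\,dx<+\infty,\qquad A=(\mu_0+\eta)(\nu_0+\eta)-1,\quad B=(1-\mu_0+\eta)(\nu_0+\eta)-1.$$ Then $f_0\in KL(\Pi^*)$. (The support of $G_0$ need not be all of $\Theta$.) -/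

import Mathlib

open MeasureTheory ProbabilityTheory Set Filter Topology
open scoped ENNReal NNReal

noncomputable section

namespace BetaCalibration

/-! ### Densities, Kullback-Leibler divergence, Kullback-Leibler property -/

/-- The set `𝓕` of probability densities with respect to Lebesgue measure on the sample space
`Y ⊆ ℝ`.  (The values outside `Y` play no role.) -/
structure Density (Y : Set ℝ) where
  toFun : ℝ → ℝ
  measurable_toFun : Measurable toFun
  nonneg : ∀ y, 0 ≤ toFun y
  lintegral_eq_one : ∫⁻ y in Y, ENNReal.ofReal (toFun y) = 1

namespace Density

variable {Y : Set ℝ}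

instance : CoeFun (Density Y) (fun _ => ℝ → ℝ) := ⟨Density.toFun⟩

/-- The probability measure `f(y) dy` on `Y`. -/
def toMeasure (f : Density Y) : Measure ℝ :=
  (volume.restrict Y).withDensity (fun y => ENNReal.ofReal (f y))

/-- The cdf `F(y) = ∫_{(-∞, y] ∩ Y} f(z) dz` of a density. -/
def cdf (f : Density Y) (y : ℝ) : ℝ :=
  ∫ z in Iic y, f z ∂(volume.restrict Y)

/-- Measurable structure on `𝓕`: generated by the maps `f ↦ ∫_A f(y) dy`, `A` Borel, that is, the
Borel σ-field of the topology of weak convergence. -/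
instance : MeasurableSpace (Density Y) :=
  MeasurableSpace.comap toMeasure inferInstance

/-- `KL(f, g) = ∫ f log (f / g)`, with values in `[0, ∞]`. -/
def KL (f g : Density Y) : ℝ≥0∞ :=
  InformationTheory.klDiv f.toMeasure g.toMeasure

/-- Kullback-Leibler neighbourhood of `f` of size `ε`. -/
def klNhd (f : Density Y) (ε : ℝ) : Set (Density Y) :=
  {g | KL f g ≤ ENNReal.ofReal ε}

/-- `f ∈ KL(Q)`: the prior `Q` on `𝓕` charges every Kullback-Leibler neighbourhood of `f`. -/
def KLProperty (f : Density Y) (Q : Measure (Density Y)) : Prop :=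
  ∀ ε : ℝ, 0 < ε → 0 < Q (f.klNhd ε)

lemma ofReal_measurable (f : Density Y) : Measurable (fun y => ENNReal.ofReal (f y)) :=
  f.measurable_toFun.ennreal_ofReal

instance (f : Density Y) : IsProbabilityMeasure f.toMeasure := by
  refine ⟨?_⟩
  rw [toMeasure, withDensity_apply _ MeasurableSet.univ, Measure.restrict_univ]
  exact f.lintegral_eq_one

lemma integrable (f : Density Y) : Integrable f.toFun (volume.restrict Y) := by
  refine ⟨f.measurable_toFun.aestronglyMeasurable, ?_⟩
  rw [hasFiniteIntegral_iff_ofReal (Eventually.of_forall f.nonneg), f.lintegral_eq_one]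
  exact ENNReal.one_lt_top

lemma cdf_eq (f : Density Y) (y : ℝ) : f.cdf y = ProbabilityTheory.cdf f.toMeasure y := by
  rw [cdf_eq_real, measureReal_def, toMeasure, withDensity_apply _ measurableSet_Iic, cdf,
    integral_eq_lintegral_of_nonneg_ae (Eventually.of_forall f.nonneg)
      f.measurable_toFun.aestronglyMeasurable]

end Density

/-! ### The probability integral transform -/

/-- If `ν` has no atoms, its cdf is continuous. -/
lemma continuous_cdf_of_noAtoms (ν : Measure ℝ) [IsProbabilityMeasure ν] [NullSingletonClass ν] :
    Continuous (cdf ν) := by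
  rw [continuous_iff_continuousAt]
  intro x
  rw [(monotone_cdf ν).continuousAt_iff_leftLim_eq_rightLim, (cdf ν).rightLim_eq]
  have h : (cdf ν).measure {x} = 0 := by rw [measure_cdf, measure_singleton]
  rw [StieltjesFunction.measure_singleton, ENNReal.ofReal_eq_zero] at h
  have := (monotone_cdf ν).leftLim_le (le_refl x)
  linarith

/-- The cdf of an atomless law, evaluated at a draw from it, is uniform on `(0, 1)`. -/
lemma map_cdf_eq_uniform (ν : Measure ℝ) [IsProbabilityMeasure ν] [NullSingletonClass ν] :
    ν.map (cdf ν) = volume.restrict (Ioo 0 1) := by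
  have hc := continuous_cdf_of_noAtoms ν
  have hm : Measurable (cdf ν) := hc.measurable
  have : IsProbabilityMeasure (ν.map (cdf ν)) := Measure.isProbabilityMeasure_map hm.aemeasurable
  have hreach : ∀ t : ℝ, 0 < t → t < 1 → ∃ s, cdf ν s = t := by
    intro t h0 h1
    obtain ⟨a, ha⟩ := ((tendsto_cdf_atBot ν).eventually (gt_mem_nhds h0)).exists
    obtain ⟨b, hb⟩ := ((tendsto_cdf_atTop ν).eventually (lt_mem_nhds h1)).exists
    exact mem_range_of_exists_le_of_exists_ge hc ⟨a, ha.le⟩ ⟨b, hb.le⟩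
  refine Measure.ext_of_Iic _ _ fun t => ?_
  rw [Measure.map_apply hm measurableSet_Iic, Measure.restrict_apply measurableSet_Iic]
  have hup : ∀ s : ℝ, 0 < s → s < 1 → t < s → ν (cdf ν ⁻¹' Iic t) ≤ ENNReal.ofReal s := by
    intro s h0 h1 hts
    obtain ⟨x, hx⟩ := hreach s h0 h1
    rw [← hx, ofReal_cdf]
    refine measure_mono fun z hz => ?_
    by_contra hzx
    have h2 := monotone_cdf ν (not_le.mp hzx).le
    have h3 : cdf ν z ≤ t := hz
    linarith
  rcases le_or_gt 1 t with h1 | h1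
  · have e1 : cdf ν ⁻¹' Iic t = univ := by
      ext z; simpa using (cdf_le_one ν z).trans h1
    have e2 : Iic t ∩ Ioo (0 : ℝ) 1 = Ioo 0 1 := by
      ext z; simp only [mem_inter_iff, mem_Iic, mem_Ioo]; constructor
      · exact fun h => h.2
      · exact fun h => ⟨by linarith [h.2], h⟩
    rw [e1, e2]; simp
  · rcases le_or_gt t 0 with h0 | h0
    · have e2 : Iic t ∩ Ioo (0 : ℝ) 1 = ∅ := by
        ext z; simp only [mem_inter_iff, mem_Iic, mem_Ioo, mem_empty_iff_false, iff_false]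
        intro h; linarith [h.1, h.2.1]
      rw [e2, measure_empty]
      refine le_antisymm (ENNReal.le_of_forall_pos_le_add fun e he _ => ?_) zero_le
      have hmin : (0 : ℝ) < min e (1 / 2) := lt_min (by exact_mod_cast he) (by norm_num)
      refine (hup (min e (1 / 2)) hmin (lt_of_le_of_lt (min_le_right _ _) (by norm_num))
        (lt_of_le_of_lt h0 hmin)).trans ?_
      rw [zero_add]
      exact (ENNReal.ofReal_le_ofReal (min_le_left _ _)).trans (by simp)
    · have e2 : Iic t ∩ Ioo (0 : ℝ) 1 = Ioc 0 t := by
        ext z; simp only [mem_inter_iff, mem_Iic, mem_Ioo, mem_Ioc]; constructor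
        · exact fun h => ⟨h.2.1, h.1⟩
        · exact fun h => ⟨h.2, h.1, by linarith [h.2]⟩
      rw [e2, Real.volume_Ioc, sub_zero]
      refine le_antisymm (ENNReal.le_of_forall_pos_le_add fun e he _ => ?_) ?_
      · have he' : (0 : ℝ) < e := by exact_mod_cast he
        have h4 : t < min (t + e) ((t + 1) / 2) := lt_min (by linarith) (by linarith)
        refine (hup _ (h0.trans h4) (lt_of_le_of_lt (min_le_right _ _) (by linarith)) h4).trans ?_
        refine (ENNReal.ofReal_le_ofReal (min_le_left _ _)).trans ?_
        rw [ENNReal.ofReal_add h0.le he'.le]; simp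
      · obtain ⟨x, hx⟩ := hreach t h0 h1
        nth_rewrite 1 [← hx]
        rw [ofReal_cdf]
        refine measure_mono fun z hz => ?_
        have := monotone_cdf ν (show z ≤ x from hz)
        simpa [hx] using this

/-! ### Linear pools and calibrated densities -/

variable {Y : Set ℝ} {M : ℕ}

/-- The pooled density `h(y|ω) = ∑ₘ ωₘ fₘ(y)`. -/
def pool (f : Fin M → Density Y) (ω : stdSimplex ℝ (Fin M)) : Density Y where
  toFun y := ∑ m, ω m * f m y
  measurable_toFun := by
    have := fun m => (f m).measurable_toFun
    fun_prop
  nonneg y := Finset.sum_nonneg fun m _ => mul_nonneg (ω.2.1 m) ((f m).nonneg y)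
  lintegral_eq_one := by
    have h1 : ∀ y, ENNReal.ofReal (∑ m, ω m * f m y)
        = ∑ m, ENNReal.ofReal (ω m) * ENNReal.ofReal (f m y) := by
      intro y
      rw [ENNReal.ofReal_sum_of_nonneg (s := Finset.univ) (f := fun m => ω m * f m y)
        fun m _ => mul_nonneg (ω.2.1 m) ((f m).nonneg y)]
      exact Finset.sum_congr rfl fun m _ => ENNReal.ofReal_mul (ω.2.1 m)
    simp_rw [h1]
    rw [lintegral_finsetSum _ fun m _ => (f m).ofReal_measurable.const_mul _]
    simp_rw [fun m => lintegral_const_mul (μ := volume.restrict Y)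
      (ENNReal.ofReal (ω m)) (f m).ofReal_measurable,
      Density.lintegral_eq_one, mul_one]
    have h2 : ∑ m, ω m = 1 := ω.2.2
    rw [← ENNReal.ofReal_sum_of_nonneg (s := Finset.univ) (f := fun m => ω m)
      fun m _ => ω.2.1 m, h2, ENNReal.ofReal_one]

/-- The pooled cdf `H(y|ω) = ∑ₘ ωₘ Fₘ(y)`. -/
def poolCdf (f : Fin M → Density Y) (ω : stdSimplex ℝ (Fin M)) (y : ℝ) : ℝ :=
  ∑ m, ω m * (f m).cdf y

lemma poolCdf_eq (f : Fin M → Density Y) (ω : stdSimplex ℝ (Fin M)) (y : ℝ) :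
    poolCdf f ω y = (pool f ω).cdf y := by
  have h : (pool f ω).cdf y
      = ∫ z in Iic y, ∑ m, ω m * f m z ∂(volume.restrict Y) := rfl
  rw [h, integral_finsetSum _ fun m _ => ((f m).integrable.integrableOn).const_mul _]
  simp_rw [integral_const_mul]
  rfl

/-- A density on the open unit interval, used as a calibration function. -/
abbrev CalibrationDensity : Type := Density (Ioo (0 : ℝ) 1)

/-- The calibrated density `y ↦ u(H(y|ω)) h(y|ω)`. -/
def calibrate (f : Fin M → Density Y) (ω : stdSimplex ℝ (Fin M)) (u : CalibrationDensity) :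
    Density Y where
  toFun y := u (poolCdf f ω y) * pool f ω y
  measurable_toFun := by
    have h1 : Measurable (poolCdf f ω) := by
      have : poolCdf f ω = cdf (pool f ω).toMeasure :=
        funext fun y => (poolCdf_eq f ω y).trans ((pool f ω).cdf_eq y)
      rw [this]
      exact (monotone_cdf _).measurable
    exact (u.measurable_toFun.comp h1).mul (pool f ω).measurable_toFun
  nonneg y := mul_nonneg (u.nonneg _) ((pool f ω).nonneg y)
  lintegral_eq_one := by
    have hH : poolCdf f ω = cdf (pool f ω).toMeasure :=
      funext fun y => (poolCdf_eq f ω y).trans ((pool f ω).cdf_eq y)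
    have : NullSingletonClass (pool f ω).toMeasure :=
      ⟨fun x => withDensity_absolutelyContinuous _ _ (measure_singleton x)⟩
    have hm : Measurable (cdf (pool f ω).toMeasure) := (monotone_cdf _).measurable
    have hu : Measurable fun x => ENNReal.ofReal (u x) := u.measurable_toFun.ennreal_ofReal
    have h2 := lintegral_map (μ := (pool f ω).toMeasure) hu hm
    rw [map_cdf_eq_uniform, u.lintegral_eq_one] at h2
    have h3 := lintegral_withDensity_eq_lintegral_mul (volume.restrict Y)
      (pool f ω).ofReal_measurable (hu.comp hm)
    refine Eq.trans ?_ (h3.symm.trans h2.symm)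
    refine lintegral_congr fun y => ?_
    rw [hH, mul_comm, ENNReal.ofReal_mul ((pool f ω).nonneg y)]
    rfl

/-! ### Beta mixtures -/

/-- The space `(0, 1) × (0, ∞)` of calibration parameters `(μ, ν)`. -/
abbrev CalParam : Type := Ioo (0 : ℝ) 1 × Ioi (0 : ℝ)

/-- The beta density with mean `μ` and precision `ν`:
`b*_{μ,ν}(x) = Γ(ν) / (Γ(μν) Γ((1-μ)ν)) x^(μν-1) (1-x)^((1-μ)ν-1)`, `0 < x < 1`. -/
def bStar (μ ν x : ℝ) : ℝ := betaPDFReal (μ * ν) ((1 - μ) * ν) x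

lemma bStar_nonneg (θ : CalParam) (x : ℝ) : 0 ≤ bStar θ.1 θ.2 x := by
  have h1 : 0 < (θ.1 : ℝ) * θ.2 := mul_pos θ.1.2.1 θ.2.2
  have h2 : 0 < (1 - (θ.1 : ℝ)) * θ.2 := mul_pos (sub_pos.2 θ.1.2.2) θ.2.2
  by_cases hx : 0 < x ∧ x < 1
  · exact (betaPDFReal_pos hx.1 hx.2 h1 h2).le
  · simp [bStar, betaPDFReal, hx]

lemma lintegral_bStar (θ : CalParam) :
    ∫⁻ x in Ioo 0 1, ENNReal.ofReal (bStar θ.1 θ.2 x) = 1 := by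
  have h1 : 0 < (θ.1 : ℝ) * θ.2 := mul_pos θ.1.2.1 θ.2.2
  have h2 : 0 < (1 - (θ.1 : ℝ)) * θ.2 := mul_pos (sub_pos.2 θ.1.2.2) θ.2.2
  rw [← lintegral_betaPDF_eq_one h1 h2, lintegral_betaPDF]
  refine setLIntegral_congr_fun measurableSet_Ioo fun x hx => ?_
  simp only [bStar, betaPDFReal]
  rw [if_pos ⟨hx.1, hx.2⟩]

lemma measurable_bStar_uncurry :
    Measurable (fun p : CalParam × ℝ => bStar p.1.1 p.1.2 p.2) := by
  have hG : ∀ g : CalParam → ℝ, Continuous g → (∀ θ, 0 < g θ) →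
      Continuous fun θ => Real.Gamma (g θ) := by
    intro g hg hpos
    rw [continuous_iff_continuousAt]
    intro θ
    refine ContinuousAt.comp (g := Real.Gamma) (f := g) ?_ hg.continuousAt
    exact (Real.differentiableAt_Gamma fun m => by
      have := hpos θ
      have h3 : (0 : ℝ) ≤ m := Nat.cast_nonneg m
      intro h; linarith).continuousAt
  have h1 : ∀ θ : CalParam, 0 < (θ.1 : ℝ) * θ.2 := fun θ => mul_pos θ.1.2.1 θ.2.2
  have h2 : ∀ θ : CalParam, 0 < (1 - (θ.1 : ℝ)) * θ.2 :=
    fun θ => mul_pos (sub_pos.2 θ.1.2.2) θ.2.2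
  have m1 := (hG (fun θ => (θ.1 : ℝ) * θ.2) (by fun_prop) h1).measurable
  have m2 := (hG (fun θ => (1 - (θ.1 : ℝ)) * θ.2) (by fun_prop) h2).measurable
  have m3 := (hG (fun θ => (θ.1 : ℝ) * θ.2 + (1 - (θ.1 : ℝ)) * θ.2) (by fun_prop)
    fun θ => add_pos (h1 θ) (h2 θ)).measurable
  unfold bStar betaPDFReal beta
  refine Measurable.ite ?_ ?_ measurable_const
  · exact measurable_snd (measurableSet_Ioo (a := (0 : ℝ)) (b := 1))
  · have m1' : Measurable fun p : CalParam × ℝ => Real.Gamma ((p.1.1 : ℝ) * p.1.2) :=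
      m1.comp measurable_fst
    have m2' : Measurable fun p : CalParam × ℝ => Real.Gamma ((1 - (p.1.1 : ℝ)) * p.1.2) :=
      m2.comp measurable_fst
    have m3' : Measurable fun p : CalParam × ℝ =>
        Real.Gamma ((p.1.1 : ℝ) * p.1.2 + (1 - (p.1.1 : ℝ)) * p.1.2) :=
      m3.comp measurable_fst
    fun_prop

lemma integral_bStar (G : Measure CalParam) (x : ℝ) :
    ∫ θ, bStar θ.1 θ.2 x ∂G = (∫⁻ θ, ENNReal.ofReal (bStar θ.1 θ.2 x) ∂G).toReal :=
  integral_eq_lintegral_of_nonneg_ae (Eventually.of_forall fun θ => bStar_nonneg θ x)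
    (measurable_bStar_uncurry.comp (measurable_id.prodMk measurable_const)).aestronglyMeasurable

/-- The beta density `b*_{μ,ν}` as a calibration density. -/
def betaDensity (θ : CalParam) : CalibrationDensity where
  toFun x := bStar θ.1 θ.2 x
  measurable_toFun := measurable_betaPDFReal _ _
  nonneg := bStar_nonneg θ
  lintegral_eq_one := lintegral_bStar θ

/-- The beta mixture `u_G(x) = ∫ b*_{μ,ν}(x) G(dμ dν)`. -/
def betaMixture (G : ProbabilityMeasure CalParam) : CalibrationDensity where
  toFun x := ∫ θ, bStar θ.1 θ.2 x ∂(G : Measure CalParam)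
  measurable_toFun := by
    simp_rw [integral_bStar]
    exact (Measurable.lintegral_prod_left
      measurable_bStar_uncurry.ennreal_ofReal).ennreal_toReal
  nonneg x := integral_nonneg fun θ => bStar_nonneg θ x
  lintegral_eq_one := by
    simp_rw [integral_bStar]
    have hm : Measurable fun p : CalParam × ℝ => ENNReal.ofReal (bStar p.1.1 p.1.2 p.2) :=
      measurable_bStar_uncurry.ennreal_ofReal
    have h1 : ∫⁻ x in Ioo 0 1, ∫⁻ θ, ENNReal.ofReal (bStar θ.1 θ.2 x) ∂(G : Measure CalParam)
        = 1 := by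
      rw [lintegral_lintegral_swap
        (f := fun x (θ : CalParam) => ENNReal.ofReal (bStar θ.1 θ.2 x))
        (hm.comp measurable_swap).aemeasurable]
      simp_rw [lintegral_bStar]
      simp
    have h2 : ∀ᵐ x ∂(volume.restrict (Ioo (0 : ℝ) 1)),
        ∫⁻ θ, ENNReal.ofReal (bStar θ.1 θ.2 x) ∂(G : Measure CalParam) < ∞ :=
      ae_lt_top (Measurable.lintegral_prod_left hm) (by rw [h1]; exact ENNReal.one_ne_top)
    rw [← h1]
    refine lintegral_congr_ae (h2.mono fun x hx => ?_)
    exact ENNReal.ofReal_toReal hx.ne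

/-- The convex combination `w u + (1 - w) v` of two calibration densities. -/
def convexComb (w : Icc (0 : ℝ) 1) (u v : CalibrationDensity) : CalibrationDensity where
  toFun x := w * u x + (1 - w) * v x
  measurable_toFun := (u.measurable_toFun.const_mul _).add (v.measurable_toFun.const_mul _)
  nonneg x := add_nonneg (mul_nonneg w.2.1 (u.nonneg x))
    (mul_nonneg (sub_nonneg.2 w.2.2) (v.nonneg x))
  lintegral_eq_one := by
    have h1 : ∀ x, ENNReal.ofReal (w * u x + (1 - w) * v x)
        = ENNReal.ofReal w * ENNReal.ofReal (u x)
          + ENNReal.ofReal (1 - w) * ENNReal.ofReal (v x) := fun x => by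
      rw [ENNReal.ofReal_add (mul_nonneg w.2.1 (u.nonneg x))
        (mul_nonneg (sub_nonneg.2 w.2.2) (v.nonneg x)), ENNReal.ofReal_mul w.2.1,
        ENNReal.ofReal_mul (sub_nonneg.2 w.2.2)]
    simp_rw [h1]
    rw [lintegral_add_left (u.measurable_toFun.ennreal_ofReal.const_mul _),
      lintegral_const_mul _ u.measurable_toFun.ennreal_ofReal,
      lintegral_const_mul _ v.measurable_toFun.ennreal_ofReal,
      u.lintegral_eq_one, v.lintegral_eq_one, mul_one, mul_one,
      ← ENNReal.ofReal_add w.2.1 (sub_nonneg.2 w.2.2)]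
    simp

/-! ### The Dirichlet process and the induced prior -/

/-- The Dirichlet distribution `Dir(a₁, …, aₙ)`, `aᵢ ≥ 0` not all zero: the law of
`(Z₁, …, Zₙ) / ∑ Zⱼ` for independent `Zᵢ ∼ Gamma(aᵢ, 1)`, with `Zᵢ = 0` when `aᵢ = 0`. -/
def dirichletDistribution {n : ℕ} (a : Fin n → ℝ) : Measure (Fin n → ℝ) :=
  (Measure.pi fun i => if 0 < a i then gammaMeasure (a i) 1 else Measure.dirac 0).map
    fun z i => z i / ∑ j, z j

/-- `P` is the law `DP(ψ, G₀)` of a Dirichlet process on `Θ` with concentration parameter `ψ` and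
base probability measure `G₀`: under `G ∼ P`, for every finite measurable partition
`A₁, …, Aₙ` of `Θ`, `(G(A₁), …, G(Aₙ)) ∼ Dir(ψ G₀(A₁), …, ψ G₀(Aₙ))`. -/
def IsDirichletProcess {Θ : Type*} [MeasurableSpace Θ] (ψ : ℝ) (G₀ : Measure Θ)
    (P : Measure (ProbabilityMeasure Θ)) : Prop :=
  ∀ (n : ℕ) (A : Fin n → Set Θ), (∀ i, MeasurableSet (A i)) →
    Pairwise (Function.onFun Disjoint A) → ⋃ i, A i = univ →
      P.map (fun (G : ProbabilityMeasure Θ) i => (G : Measure Θ).real (A i)) =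
        dirichletDistribution fun i => ψ * G₀.real (A i)

/-- The prior on densities induced by a law `P` of the mixing distribution `G` through
`G ↦ (y ↦ (∫ b*_{μ,ν}(H(y|ω)) G(dμ dν)) h(y|ω))`. -/
def inducedPrior (f : Fin M → Density Y) (ω : stdSimplex ℝ (Fin M))
    (P : Measure (ProbabilityMeasure CalParam)) : Measure (Density Y) :=
  P.map fun G => calibrate f ω (betaMixture G)

/-- The map in `inducedPrior` is measurable, so that the push-forward is genuine. -/
lemma measurable_calibrate_betaMixture (f : Fin M → Density Y) (ω : stdSimplex ℝ (Fin M)) :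
    Measurable fun G : ProbabilityMeasure CalParam => calibrate f ω (betaMixture G) := by
  rw [measurable_comap_iff]
  refine Measure.measurable_of_measurable_coe _ fun A hA => ?_
  have hH : Measurable (poolCdf f ω) := by
    have : poolCdf f ω = cdf (pool f ω).toMeasure :=
      funext fun y => (poolCdf_eq f ω y).trans ((pool f ω).cdf_eq y)
    rw [this]
    exact (monotone_cdf _).measurable
  have hk : Measurable fun p : (ProbabilityMeasure CalParam × ℝ) × CalParam =>
      ENNReal.ofReal (bStar p.2.1 p.2.2 (poolCdf f ω p.1.2)) :=
    (measurable_bStar_uncurry.comp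
      (measurable_snd.prodMk (hH.comp (measurable_snd.comp measurable_fst)))).ennreal_ofReal
  let κ : Kernel (ProbabilityMeasure CalParam × ℝ) CalParam :=
    ⟨fun p => (p.1 : Measure CalParam), measurable_subtype_coe.comp measurable_fst⟩
  have : IsMarkovKernel κ := ⟨fun p => p.1.2⟩
  have hL : Measurable fun p : ProbabilityMeasure CalParam × ℝ =>
      ∫⁻ θ, ENNReal.ofReal (bStar θ.1 θ.2 (poolCdf f ω p.2)) ∂(p.1 : Measure CalParam) :=
    Measurable.lintegral_kernel_prod_right' (κ := κ) hk
  have hF : Measurable fun p : ProbabilityMeasure CalParam × ℝ =>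
      ENNReal.ofReal (calibrate f ω (betaMixture p.1) p.2) := by
    have : (fun p : ProbabilityMeasure CalParam × ℝ =>
        ENNReal.ofReal (calibrate f ω (betaMixture p.1) p.2)) = fun p =>
        ENNReal.ofReal ((∫⁻ θ, ENNReal.ofReal (bStar θ.1 θ.2 (poolCdf f ω p.2))
          ∂(p.1 : Measure CalParam)).toReal * pool f ω p.2) := by
      funext p
      rw [← integral_bStar]
      rfl
    rw [this]
    exact (hL.ennreal_toReal.mul
      ((pool f ω).measurable_toFun.comp measurable_snd)).ennreal_ofReal
  have := hF.lintegral_prod_right' (ν := (volume.restrict Y).restrict A)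
  convert this using 2 with G
  simp only [Function.comp_apply, Density.toMeasure]
  rw [withDensity_apply _ hA]

end BetaCalibration

end

namespace BetaCalibration

/-! ### Positivity of Dirichlet probabilities -/

/-! The pooled cdf `H` carries the pooled law to the uniform law, so a comparison of two calibrated
densities is a comparison of their calibration functions on `(0, 1)`: it suffices to bound `log (u₀
/ u_G)` above by a function whose `u₀`-integral is at most `ε`, for all `G` in an event of positive
probability (`KL_calibrate_le`). Write `u₀` as the beta mixture over `Q = w₀ δ_{θ₀} + (1 - w₀) P₀`,
a law carried by the support of `G₀`. The bound has two sources of loss.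

Truncation (`exists_finset_integral_log_le`). Restrict `Q` to finitely many small neighbourhoods of
support points, always including one of `θ₀`. The truncated mixture `m` lies between `w₀ b*_{θ₀}`
and `u₀`, so `log (u₀ / m)` is dominated by `log (u₀ / (w₀ b*_{θ₀}))` and its integral tends to `0`.

Transport (`IsDirichletProcess.measure_lmix_pos`). Since `log b*_θ(x)` is affine in the two shapes
and the log normalizer, with coefficients `log x`, `log (1 - x)` and `-1`, nearby parameters give
densities comparable on all of `(0, 1)` up to the factor `(e⁻¹ x (1 - x))^s`. Each piece of the
truncated `Q` may thus be moved to an open set charged by `G₀`. Finitely many disjoint such sets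
receive at least `c` times the required masses with positive probability, because gamma laws charge
every interval of the half-line. On that event `u_G ≥ c (e⁻¹ x (1 - x))^(2s) m`.

The moment condition makes both losses integrable: `A` and `B` strictly exceed the exponents of
`b*_{θ₀}`, so the lower bound `u₀ ≥ w₀ b*_{θ₀}` leaves a positive multiple of `-log x - log (1 - x)`
to be controlled by the moment (`integrable_log_of_moment`). -/

lemma gammaMeasure_Ioo_pos {a r x y : ℝ} (ha : 0 < a) (hr : 0 < r) (hx : 0 ≤ x) (hxy : x < y) :
    0 < gammaMeasure a r (Ioo x y) := by
  rw [gammaMeasure, withDensity_apply _ measurableSet_Ioo, setLIntegral_pos_iff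
    (show Measurable (gammaPDF a r) from (measurable_gammaPDFReal a r).ennreal_ofReal)]
  have h : Function.support (gammaPDF a r) ∩ Ioo x y = Ioo x y := by
    refine inter_eq_right.2 fun z hz => ?_
    have := gammaPDFReal_pos ha hr (hx.trans_lt hz.1)
    simpa [gammaPDF, Function.mem_support] using this
  rw [h, Real.volume_Ioo]
  simpa using hxy

/-- A Dirichlet vector exceeds `c q` coordinatewise with positive probability, if `q` is a
sub-probability vector, `c < 1`, and all parameters but the first are known to be positive. -/
lemma dirichletDistribution_pos {n : ℕ} (a : Fin (n + 1) → ℝ) (ha : ∀ i : Fin n, 0 < a i.succ)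
    (q : Fin n → ℝ) (hq : ∀ i, 0 ≤ q i) (hq1 : ∑ i, q i ≤ 1) {c : ℝ} (hc0 : 0 < c) (hc1 : c < 1) :
    0 < dirichletDistribution a {z | ∀ i : Fin n, c * q i ≤ z i.succ} := by
  have hmeas : MeasurableSet {z : Fin (n + 1) → ℝ | ∀ i : Fin n, c * q i ≤ z i.succ} := by
    rw [ofPred_forall]
    exact MeasurableSet.iInter fun i => measurableSet_le measurable_const (measurable_pi_apply _)
  have hmap : Measurable fun (z : Fin (n + 1) → ℝ) i => z i / ∑ j, z j :=
    measurable_pi_lambda _ fun i => by fun_prop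
  have hfin : ∀ i, SigmaFinite (if 0 < a i then gammaMeasure (a i) 1 else Measure.dirac 0) := by
    intro i
    split_ifs with h
    · have := isProbabilityMeasure_gammaMeasure h one_pos
      infer_instance
    · infer_instance
  rw [dirichletDistribution, Measure.map_apply hmap hmeas]
  -- Solves `c (1 + (n + 1) t) = 1`: on the box below, the coordinates sum to at most `1 + (n + 1) t
  -- = 1 / c`, so normalizing costs at most the factor `c`.
  set t : ℝ := (1 - c) / (c * (n + 1)) with ht
  have hn : (0 : ℝ) < n + 1 := by positivity
  have ht0 : 0 < t := div_pos (by linarith) (by positivity)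
  have hct : c * (1 + (n + 1) * t) = 1 := by
    rw [ht]; field_simp; ring
  -- The interval of the first coordinate is closed at `0` to catch the point mass used when its
  -- parameter is not positive. The others are open, which keeps the sum strictly positive.
  let S : Fin (n + 1) → Set ℝ := Fin.cases (Ico 0 t) fun i => Ioo (q i) (q i + t)
  refine lt_of_lt_of_le ?_ (measure_mono (s := univ.pi S) ?_)
  · rw [Measure.pi_pi, pos_iff_ne_zero, Finset.prod_ne_zero_iff]
    intro i _
    rw [← pos_iff_ne_zero]
    induction i using Fin.cases with
    | zero =>
      change 0 < (if 0 < a 0 then gammaMeasure (a 0) 1 else Measure.dirac 0) (Ico 0 t)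
      split_ifs with h
      · exact (gammaMeasure_Ioo_pos h one_pos le_rfl ht0).trans_le
          (measure_mono Ioo_subset_Ico_self)
      · simp [ht0]
    | succ i =>
      change 0 < (if 0 < a i.succ then gammaMeasure (a i.succ) 1 else Measure.dirac 0)
        (Ioo (q i) (q i + t))
      rw [if_pos (ha i)]
      exact gammaMeasure_Ioo_pos (ha i) one_pos (hq i) (by linarith)
  · intro z hz i
    have h0 : z 0 ∈ Ico 0 t := hz 0 (mem_univ _)
    have hs : ∀ j : Fin n, z j.succ ∈ Ioo (q j) (q j + t) := fun j => hz j.succ (mem_univ _)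
    have hzpos : ∀ j : Fin n, 0 ≤ z j.succ := fun j => (hq j).trans (hs j).1.le
    change c * q i ≤ z i.succ / ∑ j, z j
    have hsum : ∑ j, z j ≤ 1 + (n + 1) * t := by
      rw [Fin.sum_univ_succ]
      have h1 : ∑ j : Fin n, z j.succ ≤ ∑ j : Fin n, (q j + t) :=
        Finset.sum_le_sum fun j _ => (hs j).2.le
      rw [Finset.sum_add_distrib, Finset.sum_const, Finset.card_univ, Fintype.card_fin,
        nsmul_eq_mul] at h1
      linarith [h0.2]
    have hpos : 0 < ∑ j, z j := by
      rw [Fin.sum_univ_succ]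
      have h1 := Finset.single_le_sum (f := fun j : Fin n => z j.succ) (fun j _ => hzpos j)
        (Finset.mem_univ i)
      have h2 := (hq i).trans_lt (hs i).1
      linarith [h0.1]
    rw [le_div_iff₀ hpos]
    have h3 : c * ∑ j, z j ≤ 1 := hct ▸ mul_le_mul_of_nonneg_left hsum hc0.le
    calc c * q i * ∑ j, z j = (c * ∑ j, z j) * q i := by ring
      _ ≤ 1 * q i := mul_le_mul_of_nonneg_right h3 (hq i)
      _ ≤ z i.succ := by rw [one_mul]; exact (hs i).1.le

/-- A Dirichlet process puts mass at least `c qᵢ` on each of finitely many disjoint sets charged by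
its base measure with positive probability, if `q` is a sub-probability vector and `c < 1`. -/
lemma IsDirichletProcess.measure_pos {Θ : Type*} [MeasurableSpace Θ] {ψ : ℝ} (hψ : 0 < ψ)
    {G₀ : Measure Θ} [IsFiniteMeasure G₀] {P : Measure (ProbabilityMeasure Θ)}
    (hP : IsDirichletProcess ψ G₀ P) {n : ℕ} (B : Fin n → Set Θ) (hB : ∀ i, MeasurableSet (B i))
    (hdisj : Pairwise (Function.onFun Disjoint B)) (hpos : ∀ i, 0 < G₀ (B i))
    (q : Fin n → ℝ) (hq : ∀ i, 0 ≤ q i) (hq1 : ∑ i, q i ≤ 1) {c : ℝ} (hc0 : 0 < c) (hc1 : c < 1) :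
    0 < P {G | ∀ i, c * q i ≤ (G : Measure Θ).real (B i)} := by
  -- The complement completes the partition as cell `0`; `G₀` may give it no mass, hence the freedom
  -- of the first Dirichlet parameter.
  let A : Fin (n + 1) → Set Θ := Fin.cases (⋃ i, B i)ᶜ B
  have hA : ∀ i, MeasurableSet (A i) := by
    intro i
    induction i using Fin.cases with
    | zero => exact (MeasurableSet.iUnion hB).compl
    | succ i => exact hB i
  have hAd : Pairwise (Function.onFun Disjoint A) := by
    have h0 : ∀ j, Disjoint (⋃ i, B i)ᶜ (B j) := fun j =>
      disjoint_compl_left_iff_subset.2 (subset_iUnion B j)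
    intro i j hij
    induction i using Fin.cases with
    | zero =>
      induction j using Fin.cases with
      | zero => exact absurd rfl hij
      | succ j => exact h0 j
    | succ i =>
      induction j using Fin.cases with
      | zero => exact (h0 i).symm
      | succ j => exact hdisj fun h => hij (congrArg _ h)
  have hAu : ⋃ i, A i = univ := by
    refine eq_univ_of_forall fun x => ?_
    by_cases hx : x ∈ ⋃ i, B i
    · obtain ⟨i, hi⟩ := mem_iUnion.1 hx
      exact mem_iUnion.2 ⟨i.succ, hi⟩
    · exact mem_iUnion.2 ⟨0, hx⟩
  have hmeas : Measurable fun (G : ProbabilityMeasure Θ) i => (G : Measure Θ).real (A i) :=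
    measurable_pi_lambda _ fun i =>
      ((Measure.measurable_coe (hA i)).comp measurable_subtype_coe).ennreal_toReal
  have hset : MeasurableSet {z : Fin (n + 1) → ℝ | ∀ i : Fin n, c * q i ≤ z i.succ} := by
    rw [ofPred_forall]
    exact MeasurableSet.iInter fun i => measurableSet_le measurable_const (measurable_pi_apply _)
  have key := dirichletDistribution_pos (fun i => ψ * G₀.real (A i))
    (fun i => mul_pos hψ (ENNReal.toReal_pos (hpos i).ne' (measure_ne_top _ _))) q hq hq1 hc0 hc1
  rwa [← hP (n + 1) A hA hAd hAu, Measure.map_apply hmeas hset] at key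

/-! ### Kullback-Leibler divergence of calibrated densities -/

/-- An upper bound on the log-likelihood ratio bounds the Kullback-Leibler divergence. -/
lemma klDiv_withDensity_le {Ω : Type*} [MeasurableSpace Ω] {μ ν : Measure Ω}
    [IsProbabilityMeasure μ] [IsProbabilityMeasure ν] {ρ L : Ω → ℝ} (hρ : Measurable ρ)
    (hρ0 : ∀ x, 0 ≤ ρ x) (hμ : μ = ν.withDensity fun x => ENNReal.ofReal (ρ x))
    (hL : Integrable L μ) (hle : ∀ᵐ x ∂ν, Real.log (ρ x) ≤ L x) :
    InformationTheory.klDiv μ ν ≤ ENNReal.ofReal (∫ x, L x ∂μ) := by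
  have hρ' : Measurable fun x => ENNReal.ofReal (ρ x) := hρ.ennreal_ofReal
  have hac : μ ≪ ν := hμ ▸ withDensity_absolutelyContinuous _ _
  have hrn : μ.rnDeriv ν =ᵐ[ν] fun x => ENNReal.ofReal (ρ x) := by
    rw [hμ]; exact Measure.rnDeriv_withDensity ν hρ'
  have hint1 : Integrable ρ ν := by
    refine ⟨hρ.aestronglyMeasurable, ?_⟩
    rw [hasFiniteIntegral_iff_ofReal (Eventually.of_forall hρ0)]
    have : ∫⁻ x, ENNReal.ofReal (ρ x) ∂ν = μ univ := by
      rw [hμ, withDensity_apply _ MeasurableSet.univ, Measure.restrict_univ]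
    rw [this]; exact measure_lt_top _ _
  have hint2 : Integrable (fun x => ρ x * L x) ν := by
    rw [hμ, integrable_withDensity_iff_integrable_smul' hρ'
      (Eventually.of_forall fun _ => ENNReal.ofReal_lt_top)] at hL
    refine hL.congr (Eventually.of_forall fun x => ?_)
    simp [ENNReal.toReal_ofReal (hρ0 x)]
  have e1 : ∫ x, ρ x ∂ν = 1 := by
    have h : ∫⁻ x, ENNReal.ofReal (ρ x) ∂ν = 1 := by
      rw [← measure_univ (μ := μ), hμ, withDensity_apply _ MeasurableSet.univ,
        Measure.restrict_univ]
    rw [integral_eq_lintegral_of_nonneg_ae (Eventually.of_forall hρ0) hρ.aestronglyMeasurable, h,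
      ENNReal.toReal_one]
  have e2 : ∫ x, L x ∂μ = ∫ x, ρ x * L x ∂ν := by
    rw [hμ, integral_withDensity_eq_integral_toReal_smul hρ'
      (Eventually.of_forall fun _ => ENNReal.ofReal_lt_top)]
    exact integral_congr_ae (Eventually.of_forall fun x => by simp [ENNReal.toReal_ofReal (hρ0 x)])
  -- The integrand `klFun` is nonnegative and `1 - ρ` integrates to zero, so a one-sided bound on
  -- `log ρ` is enough and `log ρ` itself need not be shown integrable.
  have hpt : ∀ᵐ x ∂ν, InformationTheory.klFun (ρ x) ≤ ρ x * L x + (1 - ρ x) := by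
    filter_upwards [hle] with x hx
    have := mul_le_mul_of_nonneg_left hx (hρ0 x)
    rw [InformationTheory.klFun]; linarith
  rw [InformationTheory.klDiv_eq_lintegral_klFun_of_ac hac]
  calc ∫⁻ x, ENNReal.ofReal (InformationTheory.klFun (μ.rnDeriv ν x).toReal) ∂ν
      ≤ ∫⁻ x, ENNReal.ofReal (ρ x * L x + (1 - ρ x)) ∂ν := by
        refine lintegral_mono_ae ?_
        filter_upwards [hpt, hrn] with x hx hr
        rw [hr, ENNReal.toReal_ofReal (hρ0 x)]
        exact ENNReal.ofReal_le_ofReal hx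
    _ = ENNReal.ofReal (∫ x, ρ x * L x + (1 - ρ x) ∂ν) := by
        refine (ofReal_integral_eq_lintegral_ofReal
          (hint2.add ((integrable_const 1).sub hint1)) ?_).symm
        filter_upwards [hpt] with x hx
        exact (InformationTheory.klFun_nonneg (hρ0 x)).trans hx
    _ = ENNReal.ofReal (∫ x, L x ∂μ) := by
        have h := integral_add hint2 ((integrable_const (1 : ℝ)).sub hint1)
        simp only [Pi.sub_apply] at h
        rw [h, integral_sub (integrable_const 1) hint1, e1, e2]
        simp

variable {Y : Set ℝ} {M : ℕ}

lemma poolCdf_eq_cdf (f : Fin M → Density Y) (ω : stdSimplex ℝ (Fin M)) :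
    poolCdf f ω = cdf (pool f ω).toMeasure :=
  funext fun y => (poolCdf_eq f ω y).trans ((pool f ω).cdf_eq y)

lemma measurable_poolCdf (f : Fin M → Density Y) (ω : stdSimplex ℝ (Fin M)) :
    Measurable (poolCdf f ω) := by
  rw [poolCdf_eq_cdf]; exact (monotone_cdf _).measurable

/-- The probability integral transform of the pooled law. -/
lemma map_poolCdf (f : Fin M → Density Y) (ω : stdSimplex ℝ (Fin M)) :
    (pool f ω).toMeasure.map (poolCdf f ω) = volume.restrict (Ioo 0 1) := by
  have : NullSingletonClass (pool f ω).toMeasure :=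
    ⟨fun x => withDensity_absolutelyContinuous _ _ (measure_singleton x)⟩
  rw [poolCdf_eq_cdf, map_cdf_eq_uniform]

lemma toMeasure_calibrate (f : Fin M → Density Y) (ω : stdSimplex ℝ (Fin M))
    (u : CalibrationDensity) :
    (calibrate f ω u).toMeasure
      = (pool f ω).toMeasure.withDensity fun y => ENNReal.ofReal (u (poolCdf f ω y)) := by
  have hu : Measurable fun y => ENNReal.ofReal (u (poolCdf f ω y)) :=
    u.ofReal_measurable.comp (measurable_poolCdf f ω)
  rw [Density.toMeasure, Density.toMeasure, ← withDensity_mul _ (pool f ω).ofReal_measurable hu]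
  congr 1
  funext y
  rw [Pi.mul_apply, mul_comm, ← ENNReal.ofReal_mul (u.nonneg _)]
  rfl

/-- The transform of the pooled law is uniform, and the weight `u ∘ H` depends on `y` only through
`H`. This turns integrals against a calibrated law into integrals on `(0, 1)`. -/
lemma map_poolCdf_calibrate (f : Fin M → Density Y) (ω : stdSimplex ℝ (Fin M))
    (u : CalibrationDensity) :
    (calibrate f ω u).toMeasure.map (poolCdf f ω) = u.toMeasure := by
  have hm := measurable_poolCdf f ω
  have hu : Measurable fun y => ENNReal.ofReal (u (poolCdf f ω y)) := u.ofReal_measurable.comp hm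
  have hg' : ∀ g : ℝ → ℝ≥0∞, Measurable g → Measurable fun y => g (poolCdf f ω y) :=
    fun g hg => hg.comp hm
  refine Measure.ext_of_lintegral _ fun g hg => ?_
  rw [lintegral_map hg hm, toMeasure_calibrate,
    lintegral_withDensity_eq_lintegral_mul _ hu (hg' g hg),
    show u.toMeasure = (volume.restrict (Ioo 0 1)).withDensity
      fun x => ENNReal.ofReal (u x) from rfl,
    lintegral_withDensity_eq_lintegral_mul _ u.ofReal_measurable hg,
    ← map_poolCdf f ω, lintegral_map (u.ofReal_measurable.mul hg) hm]
  rfl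

/-- The Kullback-Leibler divergence of two calibrated densities is controlled by any upper bound on
the log-ratio of the calibration functions. -/
lemma KL_calibrate_le (f : Fin M → Density Y) (ω : stdSimplex ℝ (Fin M))
    (u v : CalibrationDensity) {L : ℝ → ℝ} (hL : Integrable L u.toMeasure)
    (hv : ∀ᵐ x ∂(volume.restrict (Ioo (0 : ℝ) 1)), 0 < v x)
    (hle : ∀ᵐ x ∂(volume.restrict (Ioo (0 : ℝ) 1)), Real.log (u x / v x) ≤ L x) :
    (calibrate f ω u).KL (calibrate f ω v) ≤ ENNReal.ofReal (∫ x, L x ∂u.toMeasure) := by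
  have hm := measurable_poolCdf f ω
  have hv' : ∀ᵐ y ∂(pool f ω).toMeasure, 0 < v (poolCdf f ω y) :=
    ae_of_ae_map (p := fun x => 0 < v x) hm.aemeasurable (by rwa [map_poolCdf])
  have hle' : ∀ᵐ y ∂(pool f ω).toMeasure,
      Real.log (u (poolCdf f ω y) / v (poolCdf f ω y)) ≤ L (poolCdf f ω y) :=
    ae_of_ae_map (p := fun x => Real.log (u x / v x) ≤ L x) hm.aemeasurable (by rwa [map_poolCdf])
  have hvm : Measurable fun y => ENNReal.ofReal (v (poolCdf f ω y)) := v.ofReal_measurable.comp hm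
  have hρ : Measurable fun y => u (poolCdf f ω y) / v (poolCdf f ω y) :=
    (u.measurable_toFun.comp hm).div (v.measurable_toFun.comp hm)
  rw [← map_poolCdf_calibrate f ω u] at hL ⊢
  rw [integral_map hm.aemeasurable hL.aestronglyMeasurable]
  refine klDiv_withDensity_le (ρ := fun y => u (poolCdf f ω y) / v (poolCdf f ω y)) hρ
    (fun y => div_nonneg (u.nonneg _) (v.nonneg _)) ?_ (hL.comp_measurable hm) ?_
  · rw [toMeasure_calibrate, toMeasure_calibrate,
      ← withDensity_mul _ hvm hρ.ennreal_ofReal]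
    refine withDensity_congr_ae ?_
    filter_upwards [hv'] with y hy
    rw [Pi.mul_apply, ← ENNReal.ofReal_mul (v.nonneg _), mul_div_cancel₀ _ hy.ne']
  · rw [toMeasure_calibrate]
    exact (withDensity_absolutelyContinuous _ _).ae_le hle'

/-! ### Local comparison of beta densities -/

/-- The shape parameters of `b*_θ` and the logarithm of its normalizing constant. -/
noncomputable def betaCoord (θ : CalParam) : ℝ × ℝ × ℝ :=
  ((θ.1 : ℝ) * θ.2, (1 - (θ.1 : ℝ)) * θ.2,
    Real.log (beta ((θ.1 : ℝ) * θ.2) ((1 - (θ.1 : ℝ)) * θ.2)))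

lemma shape_pos (θ : CalParam) : 0 < (θ.1 : ℝ) * θ.2 ∧ 0 < (1 - (θ.1 : ℝ)) * θ.2 :=
  ⟨mul_pos θ.1.2.1 θ.2.2, mul_pos (sub_pos.2 θ.1.2.2) θ.2.2⟩

lemma continuous_betaCoord : Continuous betaCoord := by
  have hG : ∀ g : CalParam → ℝ, Continuous g → (∀ θ, 0 < g θ) →
      Continuous fun θ => Real.Gamma (g θ) := by
    intro g hg hpos
    rw [continuous_iff_continuousAt]
    intro θ
    refine ContinuousAt.comp (g := Real.Gamma) (f := g) ?_ hg.continuousAt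
    exact (Real.differentiableAt_Gamma fun m h => by
      have := hpos θ
      have h3 : (0 : ℝ) ≤ m := Nat.cast_nonneg m
      linarith).continuousAt
  have c1 : Continuous fun θ : CalParam => (θ.1 : ℝ) * θ.2 := by fun_prop
  have c2 : Continuous fun θ : CalParam => (1 - (θ.1 : ℝ)) * θ.2 := by fun_prop
  refine c1.prodMk (c2.prodMk (Continuous.log ?_ fun θ =>
    (beta_pos (shape_pos θ).1 (shape_pos θ).2).ne'))
  refine ((hG _ c1 fun θ => (shape_pos θ).1).mul (hG _ c2 fun θ => (shape_pos θ).2)).div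
    (hG _ (c1.add c2) fun θ => add_pos (shape_pos θ).1 (shape_pos θ).2) fun θ => ?_
  exact (Real.Gamma_pos_of_pos (add_pos (shape_pos θ).1 (shape_pos θ).2)).ne'

lemma log_bStar (θ : CalParam) {x : ℝ} (hx : x ∈ Ioo (0 : ℝ) 1) :
    Real.log (bStar θ.1 θ.2 x) = -(betaCoord θ).2.2 + ((betaCoord θ).1 - 1) * Real.log x
      + ((betaCoord θ).2.1 - 1) * Real.log (1 - x) := by
  have h0 := hx.1
  have h1 : 0 < 1 - x := sub_pos.2 hx.2
  have hb := beta_pos (shape_pos θ).1 (shape_pos θ).2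
  rw [bStar, betaPDFReal, if_pos ⟨hx.1, hx.2⟩, Real.log_mul, Real.log_mul, Real.log_rpow h0,
    Real.log_rpow h1, one_div, Real.log_inv]
  · rfl
  all_goals positivity

lemma bStar_pos (θ : CalParam) {x : ℝ} (hx : x ∈ Ioo (0 : ℝ) 1) : 0 < bStar θ.1 θ.2 x :=
  betaPDFReal_pos hx.1 hx.2 (shape_pos θ).1 (shape_pos θ).2

/-- The parameters whose beta density is comparable with `b*_θ`. -/
def betaNhd (s : ℝ) (θ : CalParam) : Set CalParam := betaCoord ⁻¹' Metric.ball (betaCoord θ) s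

lemma isOpen_betaNhd (s : ℝ) (θ : CalParam) : IsOpen (betaNhd s θ) :=
  Metric.isOpen_ball.preimage continuous_betaCoord

lemma mem_betaNhd_self {s : ℝ} (hs : 0 < s) (θ : CalParam) : θ ∈ betaNhd s θ :=
  Metric.mem_ball_self hs

lemma mem_betaNhd_comm {s : ℝ} {θ θ' : CalParam} : θ ∈ betaNhd s θ' ↔ θ' ∈ betaNhd s θ :=
  Metric.mem_ball_comm

/-- The factor `(e⁻¹ x (1 - x)) ^ s` by which comparable beta densities may differ. -/
noncomputable def slack (s x : ℝ) : ℝ := Real.exp (s * (Real.log x + Real.log (1 - x) - 1))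

lemma slack_pos (s x : ℝ) : 0 < slack s x := Real.exp_pos _

/-- By `log_bStar` the log-density is affine in `betaCoord`. Each coordinate moves by less than `s`
and both logarithms are nonpositive, so the log-density drops by at most `s (1 - log x - log (1 -
x))`. -/
lemma slack_mul_bStar_le {s : ℝ} {θ θ' : CalParam} (h : θ' ∈ betaNhd s θ) {x : ℝ}
    (hx : x ∈ Ioo (0 : ℝ) 1) : slack s x * bStar θ.1 θ.2 x ≤ bStar θ'.1 θ'.2 x := by
  have h0 : Real.log x ≤ 0 := Real.log_nonpos hx.1.le hx.2.le
  have h1 : Real.log (1 - x) ≤ 0 :=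
    Real.log_nonpos (sub_nonneg.2 hx.2.le) (by linarith [hx.1])
  have hd : dist (betaCoord θ') (betaCoord θ) < s := h
  rw [Prod.dist_eq, Prod.dist_eq, max_lt_iff, max_lt_iff, Real.dist_eq, Real.dist_eq, Real.dist_eq,
    abs_lt, abs_lt, abs_lt] at hd
  obtain ⟨⟨-, ha⟩, ⟨-, hb⟩, -, hl⟩ := hd
  rw [← Real.log_le_log_iff (mul_pos (slack_pos _ _) (bStar_pos θ hx)) (bStar_pos θ' hx),
    Real.log_mul (slack_pos _ _).ne' (bStar_pos θ hx).ne', slack, Real.log_exp, log_bStar θ hx,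
    log_bStar θ' hx]
  nlinarith [mul_nonneg_of_nonpos_of_nonpos (sub_nonpos.2 ha.le) h0,
    mul_nonneg_of_nonpos_of_nonpos (sub_nonpos.2 hb.le) h1]

/-! ### Beta mixtures with values in `[0, ∞]` -/

/-- The beta mixture `∫ b*_θ(x) G(dθ)`, with value `∞` where the integral diverges. -/
noncomputable def lmix (G : Measure CalParam) (x : ℝ) : ℝ≥0∞ :=
  ∫⁻ θ, ENNReal.ofReal (bStar θ.1 θ.2 x) ∂G

lemma measurable_ofReal_bStar (x : ℝ) :
    Measurable fun θ : CalParam => ENNReal.ofReal (bStar θ.1 θ.2 x) :=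
  (measurable_bStar_uncurry.comp (measurable_id.prodMk measurable_const)).ennreal_ofReal

lemma measurable_lmix (G : Measure CalParam) [SFinite G] : Measurable (lmix G) :=
  Measurable.lintegral_prod_left measurable_bStar_uncurry.ennreal_ofReal

lemma betaMixture_apply (G : ProbabilityMeasure CalParam) (x : ℝ) :
    betaMixture G x = (lmix G x).toReal := integral_bStar _ x

/-- By Tonelli the mixture integrates to one. Off this null set `toReal` loses nothing; at `∞` it
would return `0`. -/
lemma ae_lmix_lt_top (G : Measure CalParam) [IsProbabilityMeasure G] :
    ∀ᵐ x ∂(volume.restrict (Ioo (0 : ℝ) 1)), lmix G x < ∞ := by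
  refine ae_lt_top (measurable_lmix G) ?_
  have h : ∫⁻ x in Ioo 0 1, lmix G x = 1 := by
    unfold lmix
    rw [lintegral_lintegral_swap
      (f := fun x (θ : CalParam) => ENNReal.ofReal (bStar θ.1 θ.2 x))
      (measurable_bStar_uncurry.ennreal_ofReal.comp measurable_swap).aemeasurable]
    simp_rw [lintegral_bStar]
    simp
  rw [h]; exact ENNReal.one_ne_top

/-- With positive probability, the random beta mixture dominates, up to a factor close to one, the
part of a given mixture carried by finitely many neighbourhoods of points of the support. -/
lemma IsDirichletProcess.measure_lmix_pos {ψ : ℝ} (hψ : 0 < ψ) {G₀ : Measure CalParam}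
    [IsFiniteMeasure G₀] {P : Measure (ProbabilityMeasure CalParam)}
    (hP : IsDirichletProcess ψ G₀ P) (Q : Measure CalParam) [IsProbabilityMeasure Q]
    (T : Finset CalParam) (hT : ∀ θ ∈ T, θ ∈ G₀.support) {s c : ℝ} (hs : 0 < s)
    (hc0 : 0 < c) (hc1 : c < 1) :
    0 < P {G | ∀ x ∈ Ioo (0 : ℝ) 1, ENNReal.ofReal (c * slack s x ^ 2)
      * lmix (Q.restrict (⋃ θ ∈ T, betaNhd s θ)) x ≤ lmix G x} := by
  -- Two families are needed: the cells `A` split the mass of `Q` but need not contain an open set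
  -- around `τ i`, while the sets `B`, which receive the mass of `G`, are disjoint open
  -- neighbourhoods of the support points `τ i`.
  obtain ⟨U, hU, hUd⟩ := T.finite_toSet.t2_separation
  let e := T.equivFin.symm
  let τ : Fin T.card → CalParam := fun i => e i
  let O : Fin T.card → Set CalParam := fun i => betaNhd s (τ i)
  let B : Fin T.card → Set CalParam := fun i => U (τ i) ∩ O i
  let A : Fin T.card → Set CalParam := disjointed O
  have hOo : ∀ i, IsOpen (O i) := fun i => isOpen_betaNhd s _
  have hBo : ∀ i, IsOpen (B i) := fun i => (hU _).2.inter (hOo i)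
  have hBd : Pairwise (Function.onFun Disjoint B) := fun i j hij =>
    (hUd (e i).2 (e j).2 fun h => hij (e.injective (Subtype.ext h))).mono
      inter_subset_left inter_subset_left
  have hBpos : ∀ i, 0 < G₀ (B i) := fun i =>
    (Measure.mem_support_iff_forall _).1 (hT _ (e i).2) _
      ((hBo i).mem_nhds ⟨(hU _).1, mem_betaNhd_self hs _⟩)
  have hAm : ∀ i, MeasurableSet (A i) := fun i =>
    disjointedRec (fun _ j ht => ht.diff (hOo j).measurableSet) (hOo i).measurableSet
  have hAd : Pairwise (Function.onFun Disjoint A) := disjoint_disjointed O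
  have hAu : ⋃ i, A i = ⋃ θ ∈ T, betaNhd s θ := by
    rw [iUnion_disjointed]
    ext x
    simp only [mem_iUnion]
    exact ⟨fun ⟨i, hi⟩ => ⟨τ i, (e i).2, hi⟩,
      fun ⟨θ, hθ, hx⟩ => ⟨e.symm ⟨θ, hθ⟩, by simpa [O, τ] using hx⟩⟩
  have hq1 : ∑ i, Q.real (A i) ≤ 1 := by
    rw [← measureReal_iUnion_fintype hAd hAm]
    exact measureReal_le_one
  refine (hP.measure_pos hψ B (fun i => (hBo i).measurableSet) hBd hBpos (fun i => Q.real (A i))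
    (fun i => measureReal_nonneg) hq1 hc0 hc1).trans_le (measure_mono ?_)
  intro G hG x hx
  have hG' : ∀ i, ENNReal.ofReal c * Q (A i) ≤ (G : Measure CalParam) (B i) := by
    intro i
    rw [← ofReal_measureReal (μ := Q) (s := A i),
      ← ofReal_measureReal (μ := (G : Measure CalParam)),
      ← ENNReal.ofReal_mul hc0.le]
    exact ENNReal.ofReal_le_ofReal (hG i)
  set k := ENNReal.ofReal (slack s x) with hk
  have hkc : ENNReal.ofReal (c * slack s x ^ 2) = ENNReal.ofReal c * k * k := by
    rw [hk, ← ENNReal.ofReal_mul hc0.le,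
      ← ENNReal.ofReal_mul (by have := slack_pos s x; positivity)]
    ring_nf
  have step : ∀ {θ θ' : CalParam}, θ' ∈ betaNhd s θ →
      k * ENNReal.ofReal (bStar θ.1 θ.2 x) ≤ ENNReal.ofReal (bStar θ'.1 θ'.2 x) := by
    intro θ θ' h
    rw [hk, ← ENNReal.ofReal_mul (slack_pos s x).le]
    exact ENNReal.ofReal_le_ofReal (slack_mul_bStar_le h hx)
  have hi : ∀ i, ENNReal.ofReal c * k * k * ∫⁻ θ in A i, ENNReal.ofReal (bStar θ.1 θ.2 x) ∂Q
      ≤ ∫⁻ θ in B i, ENNReal.ofReal (bStar θ.1 θ.2 x) ∂(G : Measure CalParam) := by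
    intro i
    set b := ENNReal.ofReal (bStar (τ i).1 (τ i).2 x) with hb
    -- Mass travels from `A i` to the centre `τ i`, then from `τ i` into `B i`; each leg costs one
    -- factor `k`, whence the square of `slack`.
    have h1 : k * ∫⁻ θ in A i, ENNReal.ofReal (bStar θ.1 θ.2 x) ∂Q ≤ b * Q (A i) := by
      rw [← lintegral_const_mul _ (measurable_ofReal_bStar x), ← setLIntegral_const]
      exact setLIntegral_mono measurable_const fun θ hθ =>
        step (mem_betaNhd_comm.1 (disjointed_subset O i hθ))
    have h2 : k * b * (G : Measure CalParam) (B i)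
        ≤ ∫⁻ θ in B i, ENNReal.ofReal (bStar θ.1 θ.2 x) ∂(G : Measure CalParam) := by
      rw [← setLIntegral_const]
      exact setLIntegral_mono (measurable_ofReal_bStar x) fun θ hθ => step hθ.2
    calc ENNReal.ofReal c * k * k * ∫⁻ θ in A i, ENNReal.ofReal (bStar θ.1 θ.2 x) ∂Q
        = ENNReal.ofReal c * k * (k * ∫⁻ θ in A i, ENNReal.ofReal (bStar θ.1 θ.2 x) ∂Q) := by
          rw [mul_assoc]
      _ ≤ ENNReal.ofReal c * k * (b * Q (A i)) := by gcongr
      _ = k * b * (ENNReal.ofReal c * Q (A i)) := by ring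
      _ ≤ k * b * (G : Measure CalParam) (B i) := by gcongr; exact hG' i
      _ ≤ _ := h2
  calc ENNReal.ofReal (c * slack s x ^ 2) * lmix (Q.restrict (⋃ θ ∈ T, betaNhd s θ)) x
      = ∑ i, ENNReal.ofReal c * k * k * ∫⁻ θ in A i, ENNReal.ofReal (bStar θ.1 θ.2 x) ∂Q := by
        rw [hkc, lmix, ← hAu, lintegral_iUnion hAm hAd, tsum_fintype, Finset.mul_sum]
    _ ≤ ∑ i, ∫⁻ θ in B i, ENNReal.ofReal (bStar θ.1 θ.2 x) ∂(G : Measure CalParam) :=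
        Finset.sum_le_sum fun i _ => hi i
    _ = ∫⁻ θ in ⋃ i, B i, ENNReal.ofReal (bStar θ.1 θ.2 x) ∂(G : Measure CalParam) := by
        rw [lintegral_iUnion (fun i => (hBo i).measurableSet) hBd, tsum_fintype]
    _ ≤ lmix G x := setLIntegral_le_lintegral _ _

/-! ### Integrability from the moment condition -/

lemma ae_toMeasure_of_ae {u : CalibrationDensity} {p : ℝ → Prop}
    (h : ∀ᵐ x ∂(volume.restrict (Ioo (0 : ℝ) 1)), p x) : ∀ᵐ x ∂u.toMeasure, p x :=
  (withDensity_absolutelyContinuous _ _).ae_le h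

lemma ae_toMeasure_mem_Ioo (u : CalibrationDensity) : ∀ᵐ x ∂u.toMeasure, x ∈ Ioo (0 : ℝ) 1 :=
  ae_toMeasure_of_ae (ae_restrict_mem measurableSet_Ioo)

section Moment

variable {u : CalibrationDensity} {θ : CalParam} {w ζ α β A B : ℝ}

lemma integrable_rpow_of_moment (hw : 0 < w)
    (hu : ∀ x ∈ Ioo (0 : ℝ) 1, w * bStar θ.1 θ.2 x ≤ u x)
    (hmoment : ∫⁻ x in Ioo (0 : ℝ) 1,
      ENNReal.ofReal (u x ^ (ζ + 1) / (x ^ (ζ * A) * (1 - x) ^ (ζ * B))) < ∞) :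
    Integrable (fun x => u x ^ ζ / (x ^ (ζ * A) * (1 - x) ^ (ζ * B))) u.toMeasure := by
  have hum := u.measurable_toFun
  have hm : Measurable fun x => u x ^ ζ / (x ^ (ζ * A) * (1 - x) ^ (ζ * B)) := by fun_prop
  refine ⟨hm.aestronglyMeasurable, ?_⟩
  rw [hasFiniteIntegral_iff_ofReal]
  · rw [show u.toMeasure = (volume.restrict (Ioo 0 1)).withDensity
      fun x => ENNReal.ofReal (u x) from rfl,
      lintegral_withDensity_eq_lintegral_mul _ u.ofReal_measurable hm.ennreal_ofReal]
    convert hmoment using 1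
    refine setLIntegral_congr_fun measurableSet_Ioo fun x hx => ?_
    have hux : 0 < u x := (mul_pos hw (bStar_pos θ hx)).trans_le (hu x hx)
    rw [Pi.mul_apply, ← ENNReal.ofReal_mul hux.le, Real.rpow_add hux, Real.rpow_one]
    congr 1
    ring
  · filter_upwards [ae_toMeasure_mem_Ioo u] with x hx
    have h1 := Real.rpow_nonneg (u.nonneg x) ζ
    have h2 := Real.rpow_nonneg hx.1.le (ζ * A)
    have h3 := Real.rpow_nonneg (sub_nonneg.2 hx.2.le) (ζ * B)
    exact div_nonneg h1 (mul_nonneg h2 h3)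

/-- This is `log t ≤ t - 1` for `t = (u x / (x ^ A (1 - x) ^ B)) ^ ζ`, divided by `ζ`. -/
lemma log_le_of_moment (hw : 0 < w)
    (hu : ∀ x ∈ Ioo (0 : ℝ) 1, w * bStar θ.1 θ.2 x ≤ u x) (hζ : 0 < ζ) {x : ℝ}
    (hx : x ∈ Ioo (0 : ℝ) 1) :
    Real.log (u x) - A * Real.log x - B * Real.log (1 - x)
      ≤ u x ^ ζ / (x ^ (ζ * A) * (1 - x) ^ (ζ * B)) / ζ := by
  have hux : 0 < u x := (mul_pos hw (bStar_pos θ hx)).trans_le (hu x hx)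
  have h1 : 0 < 1 - x := sub_pos.2 hx.2
  have p1 := Real.rpow_pos_of_pos hux ζ
  have p2 := Real.rpow_pos_of_pos hx.1 (ζ * A)
  have p3 := Real.rpow_pos_of_pos h1 (ζ * B)
  have h := Real.log_le_sub_one_of_pos (div_pos p1 (mul_pos p2 p3))
  rw [Real.log_div p1.ne' (mul_pos p2 p3).ne', Real.log_mul p2.ne' p3.ne', Real.log_rpow hux,
    Real.log_rpow hx.1, Real.log_rpow h1] at h
  rw [le_div_iff₀ hζ]
  linarith

lemma log_mul_bStar_le (hw : 0 < w) (hu : ∀ x ∈ Ioo (0 : ℝ) 1, w * bStar θ.1 θ.2 x ≤ u x) {x : ℝ}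
    (hx : x ∈ Ioo (0 : ℝ) 1) :
    Real.log w + (-(betaCoord θ).2.2 + ((betaCoord θ).1 - 1) * Real.log x
      + ((betaCoord θ).2.1 - 1) * Real.log (1 - x)) ≤ Real.log (u x) := by
  rw [← log_bStar θ hx, ← Real.log_mul hw.ne' (bStar_pos θ hx).ne']
  exact Real.log_le_log (mul_pos hw (bStar_pos θ hx)) (hu x hx)

/-- Adding the moment bound on `log u - A log x - B log (1 - x)` to the lower bound on `log u`
cancels `log u` and leaves `-α log x - β log (1 - x)`, which is at least `min α β` times the
integrand. -/
lemma integrable_log_of_moment (hw : 0 < w)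
    (hu : ∀ x ∈ Ioo (0 : ℝ) 1, w * bStar θ.1 θ.2 x ≤ u x) (hζ : 0 < ζ) (hα : 0 < α) (hβ : 0 < β)
    (hA : A = (betaCoord θ).1 + α - 1) (hB : B = (betaCoord θ).2.1 + β - 1)
    (hmoment : ∫⁻ x in Ioo (0 : ℝ) 1,
      ENNReal.ofReal (u x ^ (ζ + 1) / (x ^ (ζ * A) * (1 - x) ^ (ζ * B))) < ∞) :
    Integrable (fun x => -(Real.log x + Real.log (1 - x))) u.toMeasure := by
  have hI := integrable_rpow_of_moment hw hu hmoment
  have hγ : 0 < min α β := lt_min hα hβ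
  refine Integrable.mono' (((hI.div_const ζ).add
    (integrable_const ((betaCoord θ).2.2 - Real.log w))).div_const (min α β)) ?_ ?_
  · exact Measurable.aestronglyMeasurable (by fun_prop)
  · filter_upwards [ae_toMeasure_mem_Ioo u] with x hx
    have h0 : Real.log x ≤ 0 := Real.log_nonpos hx.1.le hx.2.le
    have h1 : Real.log (1 - x) ≤ 0 :=
      Real.log_nonpos (sub_nonneg.2 hx.2.le) (by linarith [hx.1])
    have k1 := log_le_of_moment (A := A) (B := B) hw hu hζ hx
    have k2 := log_mul_bStar_le hw hu hx
    rw [Real.norm_of_nonneg (by linarith), le_div_iff₀ hγ, Pi.add_apply]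
    have k3 := mul_nonneg_of_nonpos_of_nonpos (sub_nonpos.2 (min_le_left α β)) h0
    have k4 := mul_nonneg_of_nonpos_of_nonpos (sub_nonpos.2 (min_le_right α β)) h1
    rw [hA, hB] at k1
    rw [hA, hB]
    linarith

/-- The logarithm is nonnegative because `w b*_θ ≤ u`. For the upper bound, replacing the exponents
of `b*_θ` by `A` and `B` leaves `α log x + β log (1 - x) ≤ 0`, which is dropped. -/
lemma integrable_log_div_of_moment (hw : 0 < w)
    (hu : ∀ x ∈ Ioo (0 : ℝ) 1, w * bStar θ.1 θ.2 x ≤ u x) (hζ : 0 < ζ) (hα : 0 < α) (hβ : 0 < β)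
    (hA : A = (betaCoord θ).1 + α - 1) (hB : B = (betaCoord θ).2.1 + β - 1)
    (hmoment : ∫⁻ x in Ioo (0 : ℝ) 1,
      ENNReal.ofReal (u x ^ (ζ + 1) / (x ^ (ζ * A) * (1 - x) ^ (ζ * B))) < ∞) :
    Integrable (fun x => Real.log (u x / (w * bStar θ.1 θ.2 x))) u.toMeasure := by
  have hI := integrable_rpow_of_moment hw hu hmoment
  refine Integrable.mono' ((hI.div_const ζ).add
    (integrable_const ((betaCoord θ).2.2 - Real.log w))) ?_ ?_
  · exact (Real.measurable_log.comp
      (u.measurable_toFun.div ((betaDensity θ).measurable_toFun.const_mul w))).aestronglyMeasurable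
  · filter_upwards [ae_toMeasure_mem_Ioo u] with x hx
    have hb := mul_pos hw (bStar_pos θ hx)
    have hux : 0 < u x := hb.trans_le (hu x hx)
    have h0 : Real.log x ≤ 0 := Real.log_nonpos hx.1.le hx.2.le
    have h1 : Real.log (1 - x) ≤ 0 :=
      Real.log_nonpos (sub_nonneg.2 hx.2.le) (by linarith [hx.1])
    have k1 := log_le_of_moment (A := A) (B := B) hw hu hζ hx
    have k2 := log_mul_bStar_le hw hu hx
    rw [Real.log_div hux.ne' hb.ne', Real.log_mul hw.ne' (bStar_pos θ hx).ne', log_bStar θ hx,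
      Real.norm_of_nonneg (by linarith), Pi.add_apply]
    have k3 := mul_nonpos_of_nonneg_of_nonpos hα.le h0
    have k4 := mul_nonpos_of_nonneg_of_nonpos hβ.le h1
    rw [hA, hB] at k1
    rw [hA, hB]
    linarith

end Moment

/-! ### Truncated mixtures -/

lemma lmix_mono {G G' : Measure CalParam} (h : G ≤ G') (x : ℝ) : lmix G x ≤ lmix G' x :=
  lintegral_mono' h le_rfl

/-- Restricting the mixing measure to finitely many neighbourhoods of support points changes the
expected log-density of the mixture by an arbitrarily small amount. -/
lemma exists_finset_integral_log_le {u : CalibrationDensity} {Q : Measure CalParam}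
    [IsProbabilityMeasure Q] {S : Set CalParam} (hQS : ∀ᵐ θ ∂Q, θ ∈ S) {θ₀ : CalParam}
    (hθ₀ : θ₀ ∈ S) {w : ℝ} (hw : 0 < w) (hQw : ENNReal.ofReal w • Measure.dirac θ₀ ≤ Q)
    (hu : ∀ᵐ x ∂(volume.restrict (Ioo (0 : ℝ) 1)), u x = (lmix Q x).toReal)
    (hint : Integrable (fun x => Real.log (u x / (w * bStar θ₀.1 θ₀.2 x))) u.toMeasure)
    {s ε : ℝ} (hs : 0 < s) (hε : 0 < ε) :
    ∃ T : Finset CalParam, (∀ θ ∈ T, θ ∈ S) ∧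
      (∀ x, ENNReal.ofReal (w * bStar θ₀.1 θ₀.2 x)
        ≤ lmix (Q.restrict (⋃ θ ∈ T, betaNhd s θ)) x) ∧
      Integrable (fun x => Real.log
        (u x / (lmix (Q.restrict (⋃ θ ∈ T, betaNhd s θ)) x).toReal)) u.toMeasure ∧
      ∫ x, Real.log (u x / (lmix (Q.restrict (⋃ θ ∈ T, betaNhd s θ)) x).toReal) ∂u.toMeasure
        ≤ ε := by
  classical
  -- Lindelöf: countably many neighbourhoods centred in `S` already cover it.
  obtain ⟨t, htS, htc, hSt⟩ := TopologicalSpace.countable_cover_nhdsWithin (f := betaNhd s) (s := S)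
    fun θ _ => mem_nhdsWithin_of_mem_nhds ((isOpen_betaNhd s θ).mem_nhds (mem_betaNhd_self hs θ))
  obtain ⟨τ, hτ⟩ := (htc.insert θ₀).exists_eq_range ⟨θ₀, mem_insert _ _⟩
  have hτS : ∀ i, τ i ∈ S := fun i => by
    have : τ i ∈ insert θ₀ t := hτ ▸ mem_range_self i
    exact this.elim (fun h => h ▸ hθ₀) fun h => htS h
  -- Inserting `θ₀` at every stage keeps the atom of `Q` in each truncation, which gives a lower
  -- bound independent of `n`.
  let T : ℕ → Finset CalParam := fun n => insert θ₀ ((Finset.range n).image τ)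
  let V : ℕ → Set CalParam := fun n => ⋃ θ ∈ T n, betaNhd s θ
  have hTmono : Monotone T := fun m n hmn =>
    Finset.insert_subset_insert _ (Finset.image_subset_image (Finset.range_mono hmn))
  have hVmono : Monotone V := fun m n hmn => biUnion_subset_biUnion_left (hTmono hmn)
  have hVm : ∀ n, MeasurableSet (V n) := fun n =>
    (isOpen_biUnion fun θ _ => isOpen_betaNhd s θ).measurableSet
  have hθV : ∀ n, θ₀ ∈ V n := fun n =>
    mem_biUnion (Finset.mem_insert_self _ _) (mem_betaNhd_self hs θ₀)
  have hSV : S ⊆ ⋃ n, V n := by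
    intro θ hθ
    obtain ⟨θ', hθ', hmem⟩ := mem_iUnion₂.1 (hSt hθ)
    obtain ⟨i, hi⟩ : θ' ∈ range τ := hτ ▸ mem_insert_of_mem _ hθ'
    exact mem_iUnion.2 ⟨i + 1, mem_biUnion
      (Finset.mem_insert_of_mem (Finset.mem_image.2 ⟨i, Finset.self_mem_range_succ i, hi⟩)) hmem⟩
  have hlow : ∀ n x, ENNReal.ofReal (w * bStar θ₀.1 θ₀.2 x) ≤ lmix (Q.restrict (V n)) x := by
    intro n x
    have h1 : ENNReal.ofReal w • Measure.dirac θ₀ ≤ Q.restrict (V n) := by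
      have := Measure.restrict_mono (subset_refl (V n)) hQw
      rwa [Measure.restrict_smul, restrict_dirac' (hVm n), if_pos (hθV n)] at this
    refine le_trans (le_of_eq ?_) (lmix_mono h1 x)
    rw [lmix, lintegral_smul_measure, lintegral_dirac' _ (measurable_ofReal_bStar x), smul_eq_mul,
      ENNReal.ofReal_mul hw.le]
  have hlim : ∀ x, Tendsto (fun n => lmix (Q.restrict (V n)) x) atTop (𝓝 (lmix Q x)) := by
    intro x
    have h1 : lmix Q x = ⨆ n, lmix (Q.restrict (V n)) x := by
      have h2 : Q.restrict (⋃ n, V n) = Q :=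
        Measure.restrict_eq_self_of_ae_mem (hQS.mono fun θ hθ => hSV hθ)
      calc lmix Q x = lmix (Q.restrict (⋃ n, V n)) x := by rw [h2]
        _ = _ := setLIntegral_iUnion_of_directed _ hVmono.directed_le
    rw [h1]
    exact tendsto_atTop_iSup fun m n hmn =>
      lmix_mono (Measure.restrict_mono (hVmono hmn) le_rfl) x
  have hfin : ∀ᵐ x ∂u.toMeasure, x ∈ Ioo (0 : ℝ) 1 ∧ lmix Q x < ∞ ∧ u x = (lmix Q x).toReal := by
    filter_upwards [ae_toMeasure_mem_Ioo u, ae_toMeasure_of_ae (ae_lmix_lt_top Q),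
      ae_toMeasure_of_ae hu] with x h1 h2 h3 using ⟨h1, h2, h3⟩
  let F : ℕ → ℝ → ℝ := fun n x => Real.log (u x / (lmix (Q.restrict (V n)) x).toReal)
  have hFm : ∀ n, AEStronglyMeasurable (F n) u.toMeasure := fun n =>
    (Real.measurable_log.comp (u.measurable_toFun.div
      (measurable_lmix (Q.restrict (V n))).ennreal_toReal)).aestronglyMeasurable
  -- The truncated mixture lies between `w b*_{θ₀}` and `u`, so `F n` is nonnegative and has an
  -- integrable majorant free of `n`.
  have hFb : ∀ n, ∀ᵐ x ∂u.toMeasure, ‖F n x‖ ≤ Real.log (u x / (w * bStar θ₀.1 θ₀.2 x)) := by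
    intro n
    filter_upwards [hfin] with x hx
    obtain ⟨hx, hfx, hux⟩ := hx
    have hb := mul_pos hw (bStar_pos θ₀ hx)
    have hle : lmix (Q.restrict (V n)) x ≤ lmix Q x := lmix_mono Measure.restrict_le_self x
    have h1 : w * bStar θ₀.1 θ₀.2 x ≤ (lmix (Q.restrict (V n)) x).toReal :=
      (ENNReal.ofReal_le_iff_le_toReal (hle.trans_lt hfx).ne).1 (hlow n x)
    have h2 : (lmix (Q.restrict (V n)) x).toReal ≤ u x := by
      rw [hux]; exact ENNReal.toReal_mono hfx.ne hle
    have hm := hb.trans_le h1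
    rw [Real.norm_of_nonneg (Real.log_nonneg ((one_le_div hm).2 h2))]
    exact Real.log_le_log (div_pos (hm.trans_le h2) hm)
      (div_le_div_of_nonneg_left (hm.trans_le h2).le hb h1)
  have hFl : ∀ᵐ x ∂u.toMeasure, Tendsto (fun n => F n x) atTop (𝓝 0) := by
    filter_upwards [hfin] with x hx
    obtain ⟨hx, hfx, hux⟩ := hx
    have hb := mul_pos hw (bStar_pos θ₀ hx)
    have hupos : 0 < u x := by
      rw [hux]
      exact hb.trans_le ((ENNReal.ofReal_le_iff_le_toReal hfx.ne).1
        ((hlow 0 x).trans (lmix_mono Measure.restrict_le_self x)))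
    have h1 : Tendsto (fun n => (lmix (Q.restrict (V n)) x).toReal) atTop (𝓝 (u x)) := by
      rw [hux]; exact (ENNReal.tendsto_toReal hfx.ne).comp (hlim x)
    have h2 : Tendsto (fun n => u x / (lmix (Q.restrict (V n)) x).toReal) atTop (𝓝 1) := by
      have h3 := (tendsto_const_nhds (x := u x)).div h1 hupos.ne'
      rwa [div_self hupos.ne'] at h3
    simpa using h2.log one_ne_zero
  have hlimF := tendsto_integral_of_dominated_convergence _ hFm hint hFb hFl
  rw [integral_zero] at hlimF
  obtain ⟨n, hn⟩ := (hlimF.eventually_le_const hε).exists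
  refine ⟨T n, fun θ hθ => ?_, hlow n, hint.mono' (hFm n) (hFb n), hn⟩
  rcases Finset.mem_insert.1 hθ with h | h
  · exact h ▸ hθ₀
  · obtain ⟨i, -, hi⟩ := Finset.mem_image.1 h
    exact hi ▸ hτS i

/-! ### The Kullback-Leibler property -/

/-- The Kullback-Leibler property at a calibrated beta mixture whose mixing measure is carried by
the support of the base measure and has an atom. -/
lemma klProperty_of_integrable (f : Fin M → Density Y) (ω : stdSimplex ℝ (Fin M)) {ψ : ℝ}
    (hψ : 0 < ψ) {G₀ : Measure CalParam} [IsFiniteMeasure G₀]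
    {P : Measure (ProbabilityMeasure CalParam)} (hP : IsDirichletProcess ψ G₀ P)
    {u : CalibrationDensity} {Q : Measure CalParam} [IsProbabilityMeasure Q]
    (hQS : ∀ᵐ θ ∂Q, θ ∈ G₀.support) {θ₀ : CalParam}
    (hθ₀ : θ₀ ∈ G₀.support) {w : ℝ} (hw : 0 < w) (hQw : ENNReal.ofReal w • Measure.dirac θ₀ ≤ Q)
    (hu : ∀ᵐ x ∂(volume.restrict (Ioo (0 : ℝ) 1)), u x = (lmix Q x).toReal)
    (hint : Integrable (fun x => Real.log (u x / (w * bStar θ₀.1 θ₀.2 x))) u.toMeasure)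
    (hlog : Integrable (fun x => -(Real.log x + Real.log (1 - x))) u.toMeasure) :
    (calibrate f ω u).KLProperty (inducedPrior f ω P) := by
  intro ε hε
  set N : ℝ := ∫ x, -(Real.log x + Real.log (1 - x)) ∂u.toMeasure with hN
  have hN0 : 0 ≤ N := by
    refine integral_nonneg_of_ae ?_
    filter_upwards [ae_toMeasure_mem_Ioo u] with x hx
    have h0 : Real.log x ≤ 0 := Real.log_nonpos hx.1.le hx.2.le
    have h1 : Real.log (1 - x) ≤ 0 :=
      Real.log_nonpos (sub_nonneg.2 hx.2.le) (by linarith [hx.1])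
    rw [Pi.zero_apply]; linarith
  -- The error `ε` is spent in thirds: on the truncation, on `c = exp (-ε / 3)`, and on the squared
  -- `slack`, whose expected negative logarithm is `2 s (N + 1)`.
  set s : ℝ := ε / (6 * (N + 1)) with hs
  have hs0 : 0 < s := by positivity
  have hsN : 2 * s * (N + 1) = ε / 3 := by rw [hs]; field_simp; norm_num
  obtain ⟨T, hTS, hlow, hTint, hTle⟩ := exists_finset_integral_log_le hQS hθ₀ hw hQw hu hint hs0
    (show 0 < ε / 3 by positivity)
  set m : ℝ → ℝ≥0∞ := lmix (Q.restrict (⋃ θ ∈ T, betaNhd s θ)) with hm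
  have hc1 : Real.exp (-(ε / 3)) < 1 := Real.exp_lt_one_iff.2 (by linarith)
  have hE := hP.measure_lmix_pos hψ Q T hTS hs0 (Real.exp_pos _) hc1
  -- The bound `Measure.le_map_apply` holds for arbitrary sets, so measurability of the
  -- Kullback-Leibler neighbourhood is not required.
  refine hE.trans_le ((measure_mono fun G hG => ?_).trans
    (Measure.le_map_apply (measurable_calibrate_betaMixture f ω).aemeasurable _))
  let L : ℝ → ℝ := fun x => Real.log (u x / (m x).toReal)
    + (ε / 3 + 2 * s * (-(Real.log x + Real.log (1 - x)) + 1))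
  have hi : Integrable (fun x : ℝ => -(Real.log x + Real.log (1 - x)) + 1) u.toMeasure :=
    hlog.add (integrable_const 1)
  have hLi' : Integrable (fun x : ℝ => ε / 3 + 2 * s * (-(Real.log x + Real.log (1 - x)) + 1))
      u.toMeasure :=
    (integrable_const _).add (hi.const_mul _)
  have hL : Integrable L u.toMeasure := hTint.add hLi'
  have hLle : ∫ x, L x ∂u.toMeasure ≤ ε := by
    have e1 : ∫ x, (ε / 3 + 2 * s * (-(Real.log x + Real.log (1 - x)) + 1)) ∂u.toMeasure
        = ε / 3 + 2 * s * (N + 1) := by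
      have h1 : ∫ x, (-(Real.log x + Real.log (1 - x)) + 1) ∂u.toMeasure = N + 1 := by
        rw [integral_add hlog (integrable_const 1), ← hN]
        simp
      rw [integral_add (integrable_const _) (hi.const_mul _), integral_const_mul, h1]
      simp
    simp only [L]
    rw [integral_add hTint hLi', e1, hsN]
    linarith
  have key : ∀ᵐ x ∂(volume.restrict (Ioo (0 : ℝ) 1)),
      0 < betaMixture G x ∧ Real.log (u x / betaMixture G x) ≤ L x := by
    filter_upwards [ae_restrict_mem measurableSet_Ioo, ae_lmix_lt_top Q,
      ae_lmix_lt_top (G : Measure CalParam), hu] with x hx hQx hGx hux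
    have hb := mul_pos hw (bStar_pos θ₀ hx)
    have hmQ : m x ≤ lmix Q x := lmix_mono Measure.restrict_le_self x
    have hmx : m x ≠ ∞ := (hmQ.trans_lt hQx).ne
    have hm0 : 0 < (m x).toReal :=
      hb.trans_le ((ENNReal.ofReal_le_iff_le_toReal hmx).1 (hlow x))
    have hu0 : 0 < u x := by
      rw [hux]; exact hm0.trans_le (ENNReal.toReal_mono hQx.ne hmQ)
    have hk := slack_pos s x
    have hck : 0 < Real.exp (-(ε / 3)) * slack s x ^ 2 := by positivity
    have hv : Real.exp (-(ε / 3)) * slack s x ^ 2 * (m x).toReal ≤ betaMixture G x := by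
      rw [betaMixture_apply, ← ENNReal.toReal_ofReal hck.le, ← ENNReal.toReal_mul]
      exact ENNReal.toReal_mono hGx.ne (hG x hx)
    have hv0 : 0 < betaMixture G x := (mul_pos hck hm0).trans_le hv
    refine ⟨hv0, ?_⟩
    have h1 := Real.log_le_log (mul_pos hck hm0) hv
    rw [Real.log_mul hck.ne' hm0.ne', Real.log_mul (Real.exp_pos _).ne' (pow_pos hk 2).ne',
      Real.log_exp, Real.log_pow, slack, Real.log_exp] at h1
    simp only [L]
    rw [Real.log_div hu0.ne' hv0.ne', Real.log_div hu0.ne' hm0.ne']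
    push_cast at h1
    linarith
  exact (KL_calibrate_le f ω u (betaMixture G) hL (key.mono fun x hx => hx.1)
    (key.mono fun x hx => hx.2)).trans (ENNReal.ofReal_le_ofReal hLle)

end BetaCalibration

open BetaCalibration in
theorem mainTheorem4
    {Y : Set ℝ} (hY : MeasurableSet Y) {M : ℕ} (f : Fin M → Density Y)
    (ω₀ : stdSimplex ℝ (Fin M))
    (ψ : ℝ) (hψ : 0 < ψ)
    (G₀ : Measure CalParam) [IsProbabilityMeasure G₀]
    (P : Measure (ProbabilityMeasure CalParam)) [IsProbabilityMeasure P]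
    (hP : IsDirichletProcess ψ G₀ P)
    (μ₀ : Ioo (0 : ℝ) 1) (ν₀ : Ioi (0 : ℝ))
    (P₀ : ProbabilityMeasure CalParam) (w₀ : Icc (0 : ℝ) 1)
    (hθ₀ : (μ₀, ν₀) ∈ G₀.support)
    (hP₀ : (P₀ : Measure CalParam).support ⊆ G₀.support)
    (u₀ : CalibrationDensity)
    (hu₀ : u₀ = convexComb w₀ (betaDensity (μ₀, ν₀)) (betaMixture P₀))
    (ζ η A B : ℝ) (hζ : 0 < ζ) (hη : 0 < η)
    (hημ : η < μ₀) (hημ' : η < 1 - μ₀) (hην : η < ν₀) (hηw : η < w₀)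
    (hA : A = ((μ₀ : ℝ) + η) * (ν₀ + η) - 1)
    (hB : B = (1 - (μ₀ : ℝ) + η) * (ν₀ + η) - 1)
    (hmoment : ∫⁻ x in Ioo (0 : ℝ) 1,
      ENNReal.ofReal (u₀ x ^ (ζ + 1) / (x ^ (ζ * A) * (1 - x) ^ (ζ * B))) < ∞) :
    (calibrate f ω₀ u₀).KLProperty (inducedPrior f ω₀ P) := by
  have hw : (0 : ℝ) < w₀ := hη.trans hηw
  have hw1 : (0 : ℝ) ≤ 1 - w₀ := sub_nonneg.2 w₀.2.2
  have hμ := μ₀.2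
  have hν : (0 : ℝ) < ν₀ := ν₀.2
  have hux : ∀ x, u₀ x = w₀ * bStar μ₀ ν₀ x + (1 - w₀) * (lmix P₀ x).toReal := by
    intro x
    rw [hu₀, ← betaMixture_apply]
    rfl
  have hlow : ∀ x ∈ Ioo (0 : ℝ) 1, w₀ * bStar μ₀ ν₀ x ≤ u₀ x := fun x _ => by
    rw [hux]
    exact le_add_of_nonneg_right (mul_nonneg hw1 ENNReal.toReal_nonneg)
  -- From `(μ₀ + η)(ν₀ + η) = μ₀ ν₀ + η (μ₀ + ν₀ + η)`: the excess of `A` over the exponent of `x`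
  -- in `b*_{μ₀,ν₀}`, and likewise for `B` with `1 - μ₀`.
  have hα : 0 < η * (μ₀ + ν₀ + η) := mul_pos hη (by linarith [hμ.1])
  have hβ : 0 < η * (1 - μ₀ + ν₀ + η) := mul_pos hη (by linarith [hμ.2])
  have hA' : A = (betaCoord (μ₀, ν₀)).1 + η * (μ₀ + ν₀ + η) - 1 := by
    rw [hA, betaCoord]; ring
  have hB' : B = (betaCoord (μ₀, ν₀)).2.1 + η * (1 - μ₀ + ν₀ + η) - 1 := by
    rw [hB, betaCoord]; ring
  let Q : Measure CalParam := ENNReal.ofReal w₀ • Measure.dirac (μ₀, ν₀)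
    + ENNReal.ofReal (1 - w₀) • (P₀ : Measure CalParam)
  have hQ : IsProbabilityMeasure Q := ⟨by
    simp only [Q, Measure.add_apply, Measure.smul_apply, measure_univ, smul_eq_mul, mul_one]
    rw [← ENNReal.ofReal_add hw.le hw1]
    simp⟩
  have hQS : ∀ᵐ θ ∂Q, θ ∈ G₀.support := by
    refine ae_add_measure_iff.2 ⟨Measure.ae_smul_measure ?_ _, Measure.ae_smul_measure ?_ _⟩
    · exact (ae_dirac_iff (p := fun θ => θ ∈ G₀.support)
        Measure.isClosed_support.measurableSet).2 hθ₀
    · have h : ∀ᵐ θ ∂(P₀ : Measure CalParam), θ ∈ (P₀ : Measure CalParam).support :=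
        Measure.support_mem_ae
      exact h.mono fun θ hθ => hP₀ hθ
  -- Only almost everywhere: where the mixture over `P₀` diverges, `toReal` yields `0` and the two
  -- sides may differ.
  have hQx : ∀ᵐ x ∂(volume.restrict (Ioo (0 : ℝ) 1)), u₀ x = (lmix Q x).toReal := by
    filter_upwards [ae_lmix_lt_top (P₀ : Measure CalParam)] with x hx
    have h : lmix Q x = ENNReal.ofReal w₀ * ENNReal.ofReal (bStar μ₀ ν₀ x)
        + ENNReal.ofReal (1 - w₀) * lmix P₀ x := by
      simp only [lmix, Q]
      rw [lintegral_add_measure, lintegral_smul_measure, lintegral_smul_measure,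
        lintegral_dirac' _ (measurable_ofReal_bStar x), smul_eq_mul, smul_eq_mul]
    rw [hux, h, ENNReal.toReal_add (by finiteness) (by finiteness), ENNReal.toReal_mul,
      ENNReal.toReal_mul, ENNReal.toReal_ofReal hw.le, ENNReal.toReal_ofReal hw1,
      ENNReal.toReal_ofReal (bStar_nonneg (μ₀, ν₀) x)]
  exact klProperty_of_integrable f ω₀ hψ hP hQS hθ₀ hw (Measure.le_add_right le_rfl) hQx
    (integrable_log_div_of_moment (θ := (μ₀, ν₀)) hw hlow hζ hα hβ hA' hB' hmoment)
    (integrable_log_of_moment (θ := (μ₀, ν₀)) hw hlow hζ hα hβ hA' hB' hmoment)
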